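/- Let $R$ be an associative ring with unit, not necessarily commutative, and let $\mathbb{F}$ be a class of left $R$-modules closed under isomorphisms. A submodule $N$ of a left $R$-module $M$ is called pure if the sequence $0 \to Q \otimes_R N \to Q \otimes_R M \to Q \otimes_R (M/N) \to 0$ is exact for every right $R$-module $Q$; then $M/N$ is called a pure quotient module of $M$. Suppose that $\mathbb{F}$ is closed under pure quotient modules, that is, if $M$ is in $\mathbb{F}$ and $N$ is a pure submodule of $M$, then $M/N$ is in $\mathbb{F}$. Then the following conditions are equivalent. (i) $\mathbb{F}$ is closed under set-indexed direct sums (the empty direct sum $0$ included). (ii) $\mathbb{F}$ is precovering: each left $R$-module $M$ has an $\mathbb{F}$-precover, that is, a homomorphism $\varphi : F \to M$ with $F$ in $\mathbb{F}$ such that each homomorphism $F' \to M$ with $F'$ in $\mathbb{F}$ factors as $F' \to F \xrightarrow{\varphi} M$. (iii) $\mathbb{F}$ is covering: each left $R$-module $M$ has an $\mathbb{F}$-cover, that is, an $\mathbb{F}$-precover $\varphi : F \to M$ such that each endomorphism $e : F \to F$ with $\varphi \circ e = \varphi$ is an automorphism. -/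

import Mathlib

open CategoryTheory
open scoped TensorProduct DirectSum

universe u

noncomputable section

namespace PureCover

/-- The relations `q r ⊗ m = q ⊗ r m` that cut the tensor product over an arbitrary ring `R` of a
right module `Q` (a module over `Rᵐᵒᵖ`) and a left module `M` out of the tensor product over `ℤ`. -/
def balancedRel (R : Type u) [Ring R] (Q : Type u) [AddCommGroup Q] [Module Rᵐᵒᵖ Q]
    (M : Type u) [AddCommGroup M] [Module R M] : AddSubgroup (Q ⊗[ℤ] M) :=
  AddSubgroup.closure
    {x | ∃ (q : Q) (r : R) (m : M), x = (MulOpposite.op r • q) ⊗ₜ[ℤ] m - q ⊗ₜ[ℤ] (r • m)}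

/-- The tensor product `Q ⊗_R M`, an abelian group, of a right module `Q` and a left module `M`
over a ring `R` that need not be commutative. -/
abbrev Tensor (R : Type u) [Ring R] (Q : Type u) [AddCommGroup Q] [Module Rᵐᵒᵖ Q]
    (M : Type u) [AddCommGroup M] [Module R M] : Type u :=
  (Q ⊗[ℤ] M) ⧸ balancedRel R Q M

/-- The homomorphism `Q ⊗_R f : Q ⊗_R M → Q ⊗_R N`, `q ⊗ m ↦ q ⊗ f m`, of abelian groups. -/
def Tensor.map {R : Type u} [Ring R] (Q : Type u) [AddCommGroup Q] [Module Rᵐᵒᵖ Q]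
    {M N : Type u} [AddCommGroup M] [Module R M] [AddCommGroup N] [Module R N]
    (f : M →ₗ[R] N) : Tensor R Q M →+ Tensor R Q N :=
  QuotientAddGroup.map (balancedRel R Q M) (balancedRel R Q N)
    (LinearMap.lTensor Q (f.restrictScalars ℤ)).toAddMonoidHom (by
      rw [balancedRel, AddSubgroup.closure_le]
      rintro _ ⟨q, r, m, rfl⟩
      exact AddSubgroup.subset_closure ⟨q, r, f m, by simp⟩)

/-- A submodule `N` of a left module `M` is pure if the short exact sequence
`0 → N → M → M ⧸ N → 0` stays exact when it is tensored with any right module. -/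
def IsPure {R : Type u} [Ring R] {M : Type u} [AddCommGroup M] [Module R M]
    (N : Submodule R M) : Prop :=
  ∀ (Q : Type u) [AddCommGroup Q] [Module Rᵐᵒᵖ Q],
    Function.Injective (Tensor.map Q N.subtype) ∧
    Function.Exact (Tensor.map Q N.subtype) (Tensor.map Q N.mkQ) ∧
    Function.Surjective (Tensor.map Q N.mkQ)

variable {R : Type u} [Ring R]

/-- If `M` is in the class and `N` is a pure submodule of `M`, then `M ⧸ N` is in the class. -/
def ClosedUnderPureQuotients (F : ObjectProperty (ModuleCat.{u} R)) : Prop :=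
  ∀ M : ModuleCat.{u} R, F M → ∀ N : Submodule R M, IsPure N → F (ModuleCat.of R (M ⧸ N))

/-- Closure under direct sums indexed by arbitrary sets, the empty set included. -/
def ClosedUnderDirectSums (F : ObjectProperty (ModuleCat.{u} R)) : Prop :=
  ∀ (ι : Type u) (M : ι → ModuleCat.{u} R), (∀ i, F (M i)) → F (ModuleCat.of R (⨁ i, M i))

/-- `φ : X ⟶ M` is an `F`-precover of `M`. -/
def IsPrecover (F : ObjectProperty (ModuleCat.{u} R)) {X M : ModuleCat.{u} R} (φ : X ⟶ M) : Prop :=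
  F X ∧ ∀ Y : ModuleCat.{u} R, F Y → ∀ g : Y ⟶ M, ∃ h : Y ⟶ X, h ≫ φ = g

/-- `φ : X ⟶ M` is an `F`-cover of `M`. -/
def IsCover (F : ObjectProperty (ModuleCat.{u} R)) {X M : ModuleCat.{u} R} (φ : X ⟶ M) : Prop :=
  IsPrecover F φ ∧ ∀ e : X ⟶ X, e ≫ φ = φ → IsIso e

/-- Every left module has an `F`-precover. -/
def IsPrecovering (F : ObjectProperty (ModuleCat.{u} R)) : Prop :=
  ∀ M : ModuleCat.{u} R, ∃ (X : ModuleCat.{u} R) (φ : X ⟶ M), IsPrecover F φ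

/-- Every left module has an `F`-cover. -/
def IsCovering (F : ObjectProperty (ModuleCat.{u} R)) : Prop :=
  ∀ M : ModuleCat.{u} R, ∃ (X : ModuleCat.{u} R) (φ : X ⟶ M), IsCover F φ

end PureCover

end

/-! (ii) ⇒ (i): the inclusions of the summands lift along a precover of the direct sum, so the
precover is a split epimorphism, and its kernel is pure.

(i) ⇒ (ii): with `μ = max(#R, #M, ℵ₀)`, each `g : X → M` factors through some `X ⧸ P` with `P` pure
and `#(X ⧸ P) ≤ 2 ^ μ` (`exists_isEquationallyPure_quotient_card_le`). Hence a sum over a set of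
small modules in the class, with all their homomorphisms to `M`, is a precover. Here `P` is a
maximal pure submodule of `ker g`: a larger quotient would contain a further nonzero pure submodule
on which the induced map vanishes.

(i) ⇒ (iii): a filtered colimit is a pure quotient of a direct sum, so the members of the class over
`M` form a category with filtered colimits. A precover is a weakly terminal object in it, and
transfinite chains lead to one whose endomorphisms are bijective
(`exists_weakly_terminal_bijective`).

Purity is verified through linear equations; only the implication from equational purity to purity
is needed. -/

/-- Purity of a submodule in terms of systems of linear equations: the finitely many linear
expressions in `M` that have a value in `N` take the same values at suitable elements of `N`. -/
def Submodule.IsEquationallyPure {R M : Type*} [Ring R] [AddCommGroup M] [Module R M]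
    (N : Submodule R M) : Prop :=
  ∀ s : Finset (M →₀ R), ∃ ρ : M → M, (∀ m, ρ m ∈ N) ∧
    ∀ c ∈ s, Finsupp.linearCombination R id c ∈ N →
      Finsupp.linearCombination R ρ c = Finsupp.linearCombination R id c

namespace PureCover

/-! ### Equational purity implies purity. -/

section Tensor

variable {R : Type u} [Ring R] (Q : Type u) [AddCommGroup Q] [Module Rᵐᵒᵖ Q]
  {M : Type u} [AddCommGroup M] [Module R M]

/-- The pure tensor `q ⊗ m` in `Q ⊗_R M`. -/
def Tensor.tmul (q : Q) (m : M) : Tensor R Q M :=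
  QuotientAddGroup.mk (q ⊗ₜ[ℤ] m)

variable {Q}

theorem Tensor.tmul_add (q : Q) (m m' : M) :
    Tensor.tmul (R := R) Q q (m + m') = Tensor.tmul Q q m + Tensor.tmul Q q m' := by
  simp [Tensor.tmul, TensorProduct.tmul_add]

theorem Tensor.add_tmul (q q' : Q) (m : M) :
    Tensor.tmul (R := R) Q (q + q') m = Tensor.tmul Q q m + Tensor.tmul Q q' m := by
  simp [Tensor.tmul, TensorProduct.add_tmul]

theorem Tensor.op_smul_tmul (r : R) (q : Q) (m : M) :
    Tensor.tmul (R := R) Q (MulOpposite.op r • q) m = Tensor.tmul Q q (r • m) := by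
  rw [← sub_eq_zero, Tensor.tmul, Tensor.tmul, ← QuotientAddGroup.mk_sub,
    QuotientAddGroup.eq_zero_iff]
  exact AddSubgroup.subset_closure ⟨q, r, m, rfl⟩

theorem Tensor.hom_ext {A : Type*} [AddCommGroup A] {f g : Tensor R Q M →+ A}
    (h : ∀ q m, f (Tensor.tmul Q q m) = g (Tensor.tmul Q q m)) : f = g := by
  refine QuotientAddGroup.addMonoidHom_ext _ (AddMonoidHom.ext fun x => ?_)
  induction x using TensorProduct.induction_on with
  | zero => simp
  | tmul q m => exact h q m
  | add x y hx hy => rw [map_add, map_add, hx, hy]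

/-- The homomorphism out of `Q ⊗_R M` given by a balanced biadditive map. -/
def Tensor.lift {A : Type*} [AddCommGroup A] (f : Q →+ M →+ A)
    (hf : ∀ (r : R) q m, f (MulOpposite.op r • q) m = f q (r • m)) : Tensor R Q M →+ A :=
  QuotientAddGroup.lift (balancedRel R Q M)
    (TensorProduct.liftAddHom f fun n q m => by simp) (by
      rw [balancedRel, AddSubgroup.closure_le]
      rintro _ ⟨q, r, m, rfl⟩
      simp [hf])

@[simp]
theorem Tensor.map_tmul {N : Type u} [AddCommGroup N] [Module R N] (f : M →ₗ[R] N)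
    (q : Q) (m : M) : Tensor.map Q f (Tensor.tmul Q q m) = Tensor.tmul Q q (f m) := rfl

variable (Q)

open Filter in
/-- The approximate retractions of `M` onto an equationally pure submodule `N` combine into a
homomorphism from `Q ⊗_R M` to germs in `Q ⊗_R N`, which retracts `Q ⊗_R N → Q ⊗_R M`. -/
theorem Tensor.map_subtype_injective {N : Submodule R M} (hN : N.IsEquationallyPure) :
    Function.Injective (Tensor.map Q N.subtype) := by
  choose ρ hρN hρ using hN
  let l : Filter (Finset (M →₀ R)) := atTop
  let τ (s : Finset (M →₀ R)) (m : M) : N := ⟨ρ s m, hρN s m⟩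
  have ev (c : M →₀ R) (hc : Finsupp.linearCombination R id c ∈ N) :
      ∀ᶠ s in l, Finsupp.linearCombination R (ρ s) c = Finsupp.linearCombination R id c := by
    filter_upwards [eventually_ge_atTop {c}] with s hs
    exact hρ s c (hs (Finset.mem_singleton_self c)) hc
  have τ_add (m m' : M) : ∀ᶠ s in l, τ s (m + m') = τ s m + τ s m' := by
    filter_upwards [ev (Finsupp.single (m + m') 1 - Finsupp.single m 1 - Finsupp.single m' 1)
      (by simp)] with s hs
    apply Subtype.ext
    simpa [sub_eq_zero, sub_sub, τ] using hs
  have τ_smul (r : R) (m : M) : ∀ᶠ s in l, τ s (r • m) = r • τ s m := by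
    filter_upwards [ev (Finsupp.single (r • m) 1 - Finsupp.single m r) (by simp)] with s hs
    apply Subtype.ext
    simpa [sub_eq_zero, τ] using hs
  have τ_coe (n : N) : ∀ᶠ s in l, τ s n = n := by
    filter_upwards [ev (Finsupp.single (n : M) 1) (by simp)] with s hs
    apply Subtype.ext
    simpa [τ] using hs
  let g (q : Q) (m : M) : l.Germ (Tensor R Q N) :=
    ((fun s => Tensor.tmul Q q (τ s m) : Finset (M →₀ R) → Tensor R Q N) : l.Germ _)
  have g_add (q : Q) (m m' : M) : g q (m + m') = g q m + g q m' := by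
    refine Germ.coe_eq.2 ?_
    filter_upwards [τ_add m m'] with s hs
    simp [hs, Tensor.tmul_add]
  have add_g (q q' : Q) (m : M) : g (q + q') m = g q m + g q' m :=
    Germ.coe_eq.2 (Eventually.of_forall fun s => Tensor.add_tmul _ _ _)
  let Φ : Tensor R Q M →+ l.Germ (Tensor R Q N) :=
    Tensor.lift (AddMonoidHom.mk' (fun q => AddMonoidHom.mk' (g q) (g_add q))
      fun q q' => AddMonoidHom.ext fun m => add_g q q' m) fun r q m => by
        refine Germ.coe_eq.2 ?_
        filter_upwards [τ_smul r m] with s hs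
        simp [hs, Tensor.op_smul_tmul]
  let const : Tensor R Q N →+ l.Germ (Tensor R Q N) :=
    AddMonoidHom.mk' (fun x => ((x : Tensor R Q N) : l.Germ _)) fun x y => rfl
  have key : Φ.comp (Tensor.map Q N.subtype) = const := by
    refine Tensor.hom_ext fun q n => ?_
    simp only [AddMonoidHom.comp_apply, Tensor.map_tmul, Φ]
    refine Germ.coe_eq.2 ?_
    filter_upwards [τ_coe n] with s hs
    simp [hs]
  intro x y hxy
  have := congrArg Φ hxy
  simp only [← AddMonoidHom.comp_apply, key] at this
  -- Finite sets are directed, so `atTop` is a proper filter and constant germs determine their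
  -- values.
  exact Germ.const_inj.1 this

theorem Tensor.map_mkQ_surjective (N : Submodule R M) :
    Function.Surjective (Tensor.map Q N.mkQ) := by
  intro y
  obtain ⟨y, rfl⟩ := QuotientAddGroup.mk_surjective y
  obtain ⟨x, rfl⟩ := LinearMap.lTensor_surjective Q
    (g := N.mkQ.restrictScalars ℤ) N.mkQ_surjective y
  exact ⟨QuotientAddGroup.mk x, rfl⟩

/-- The balancing relations over `M ⧸ N` lift to relations over `M`; subtracting such a lift reduces
the claim to right exactness over `ℤ`. -/
theorem Tensor.exact_map_subtype_mkQ (N : Submodule R M) :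
    Function.Exact (Tensor.map Q N.subtype) (Tensor.map Q N.mkQ) := by
  let ι := N.subtype.restrictScalars ℤ
  let π := N.mkQ.restrictScalars ℤ
  have hex : Function.Exact (LinearMap.lTensor Q ι) (LinearMap.lTensor Q π) :=
    lTensor_exact Q (f := ι) (g := π) (fun x => by simp [ι, π]) N.mkQ_surjective
  have hrel : balancedRel R Q (M ⧸ N) ≤
      (balancedRel R Q M).map (LinearMap.lTensor Q π).toAddMonoidHom := by
    rw [balancedRel, AddSubgroup.closure_le]
    rintro _ ⟨q, r, m, rfl⟩
    obtain ⟨m, rfl⟩ := N.mkQ_surjective m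
    exact ⟨_, AddSubgroup.subset_closure ⟨q, r, m, rfl⟩, by simp [π]⟩
  intro y
  constructor
  · intro hy
    obtain ⟨y, rfl⟩ := QuotientAddGroup.mk_surjective y
    have hy' : LinearMap.lTensor Q π y ∈ balancedRel R Q (M ⧸ N) :=
      (QuotientAddGroup.eq_zero_iff _).1 hy
    obtain ⟨z, hz, hzy⟩ := hrel hy'
    obtain ⟨x, hx⟩ := (hex (y - z)).1 (by rw [map_sub, sub_eq_zero]; exact hzy.symm)
    refine ⟨QuotientAddGroup.mk x, ?_⟩
    change QuotientAddGroup.mk (LinearMap.lTensor Q ι x) = _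
    rw [hx, QuotientAddGroup.mk_sub, (QuotientAddGroup.eq_zero_iff z).2 hz, sub_zero]
  · rintro ⟨x, rfl⟩
    obtain ⟨x, rfl⟩ := QuotientAddGroup.mk_surjective x
    change QuotientAddGroup.mk (LinearMap.lTensor Q π (LinearMap.lTensor Q ι x)) = _
    rw [hex.apply_apply_eq_zero]
    rfl

end Tensor

/-- Equationally pure submodules are pure. -/
theorem isPure_of_isEquationallyPure {R : Type u} [Ring R] {M : Type u} [AddCommGroup M]
    [Module R M] {N : Submodule R M} (hN : N.IsEquationallyPure) : IsPure N := fun Q _ _ =>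
  ⟨Tensor.map_subtype_injective Q hN, Tensor.exact_map_subtype_mkQ Q N,
    Tensor.map_mkQ_surjective Q N⟩

end PureCover

/-! ### Closure properties of equationally pure submodules. -/

namespace Submodule.IsEquationallyPure

variable {R M : Type*} [Ring R] [AddCommGroup M] [Module R M]

/-- The expressions with value in `N` are the rows of a matrix, and the elements of their supports
are the unknowns. -/
theorem of_finite_systems {N : Submodule R M}
    (h : ∀ (k n : ℕ) (A : Fin k → Fin n → R) (x : Fin n → M),
      (∀ i, ∑ j, A i j • x j ∈ N) →
        ∃ y : Fin n → M, (∀ j, y j ∈ N) ∧ ∀ i, ∑ j, A i j • y j = ∑ j, A i j • x j) :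
    N.IsEquationallyPure := by
  classical
  intro s
  let s' := s.filter fun c => Finsupp.linearCombination R id c ∈ N
  let U : Finset M := s.biUnion Finsupp.support
  let e := U.equivFin
  let d := s'.equivFin
  have lc (v : M → M) (c : M →₀ R) (hc : c ∈ s) :
      Finsupp.linearCombination R v c = ∑ j, c (e.symm j) • v (e.symm j) := by
    rw [Finsupp.linearCombination_apply, Finsupp.sum_of_support_subset c (s := U)
      (Finset.subset_biUnion_of_mem Finsupp.support hc) _ (by simp), ← Finset.sum_coe_sort U]
    exact (e.symm.sum_comp fun m : U => c m • v m).symm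
  have mem (i) : (d.symm i : M →₀ R) ∈ s := (Finset.mem_filter.1 (d.symm i).2).1
  obtain ⟨y, hyN, hy⟩ := h _ _ (fun i j => (d.symm i : M →₀ R) (e.symm j))
    (fun j => (e.symm j : M)) fun i => by
      have := (Finset.mem_filter.1 (d.symm i).2).2
      rw [lc _ _ (mem i)] at this
      exact this
  refine ⟨fun m => if hm : m ∈ U then y (e ⟨m, hm⟩) else 0, fun m => ?_, fun c hc hcN => ?_⟩
  · dsimp only
    split_ifs
    exacts [hyN _, N.zero_mem]
  · have := hy (d ⟨c, Finset.mem_filter.2 ⟨hc, hcN⟩⟩)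
    rw [lc _ c hc, lc _ c hc]
    simpa using this

theorem bot : (⊥ : Submodule R M).IsEquationallyPure := fun _ =>
  ⟨0, fun _ => Submodule.zero_mem _, fun c _ hc => by
    rw [(Submodule.mem_bot R).1 hc]
    simp⟩

/-- The kernel of a split epimorphism is equationally pure. -/
theorem ker_of_comp_eq_id {N : Type*} [AddCommGroup N] [Module R N] {f : M →ₗ[R] N}
    {g : N →ₗ[R] M} (h : f ∘ₗ g = LinearMap.id) : (LinearMap.ker f).IsEquationallyPure := by
  intro s
  have hfg (n : N) : f (g n) = n := LinearMap.congr_fun h n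
  refine ⟨fun m => m - g (f m), fun m => by simp [hfg], fun c _ hc => ?_⟩
  have : (fun m => m - g (f m)) = (LinearMap.id - g ∘ₗ f : M →ₗ[R] M) ∘ id := rfl
  rw [this, ← Finsupp.apply_linearCombination, LinearMap.sub_apply, LinearMap.comp_apply,
    LinearMap.mem_ker.1 hc]
  simp

/-- Solve modulo `P` and lift the solution to `τ`. The error in each equation is an expression in `δ
= τ - id` with value in `P`, so purity of `P` corrects `τ` by `ρ ∘ δ`. -/
theorem comap_mkQ {P : Submodule R M} (hP : P.IsEquationallyPure) {N : Submodule R (M ⧸ P)}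
    (hN : N.IsEquationallyPure) : (N.comap P.mkQ).IsEquationallyPure := by
  classical
  intro s
  obtain ⟨σ, hσN, hσ⟩ := hN (s.image (Finsupp.mapDomain P.mkQ))
  choose τ hτ using fun m => P.mkQ_surjective (σ (P.mkQ m))
  let δ (m : M) : M := τ m - m
  have lcδ (ρ : M → M) (c : M →₀ R) : Finsupp.linearCombination R (τ - ρ ∘ δ) c =
      Finsupp.linearCombination R τ c -
        Finsupp.linearCombination R ρ (Finsupp.mapDomain δ c) := by
    rw [Finsupp.linearCombination_mapDomain]
    simp [Finsupp.linearCombination_apply, Finsupp.sum, smul_sub]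
  have lcδ' (c : M →₀ R) : Finsupp.linearCombination R id (Finsupp.mapDomain δ c) =
      Finsupp.linearCombination R τ c - Finsupp.linearCombination R id c := by
    rw [Finsupp.linearCombination_mapDomain]
    simp [Finsupp.linearCombination_apply, Finsupp.sum, smul_sub, δ]
  obtain ⟨ρ, hρP, hρ⟩ := hP (s.image (Finsupp.mapDomain δ))
  refine ⟨τ - ρ ∘ δ, fun m => ?_, fun c hc hcN => ?_⟩
  · have : P.mkQ (ρ (δ m)) = 0 := by simpa using hρP _
    rw [Submodule.mem_comap, Pi.sub_apply, Function.comp_apply, map_sub, this, sub_zero, hτ]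
    exact hσN _
  · have h1 := hσ _ (Finset.mem_image_of_mem _ hc) (by
      rw [Finsupp.linearCombination_mapDomain]
      rw [Submodule.mem_comap, Finsupp.apply_linearCombination] at hcN
      exact hcN)
    have h2 : P.mkQ (Finsupp.linearCombination R τ c) =
        P.mkQ (Finsupp.linearCombination R id c) := by
      rw [Finsupp.apply_linearCombination, Finsupp.apply_linearCombination,
        show P.mkQ ∘ τ = σ ∘ P.mkQ from funext hτ, ← Finsupp.linearCombination_mapDomain, h1,
        Finsupp.linearCombination_mapDomain]
      rfl
    rw [lcδ, hρ _ (Finset.mem_image_of_mem _ hc), lcδ', sub_sub_cancel]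
    rw [lcδ']
    rwa [← P.ker_mkQ, LinearMap.mem_ker, map_sub, sub_eq_zero]

/-- Finitely many expressions have finitely many values, and those in the supremum lie in a single
member of `S`. -/
theorem sSup_of_directedOn {S : Set (Submodule R M)} (hne : S.Nonempty)
    (hd : DirectedOn (· ≤ ·) S) (hS : ∀ N ∈ S, N.IsEquationallyPure) :
    (sSup S).IsEquationallyPure := by
  classical
  intro s
  have key : ∀ t : Finset M, ∃ N ∈ S, ∀ m ∈ t, m ∈ sSup S → m ∈ N := by
    intro t
    induction t using Finset.induction_on with
    | empty => exact hne.imp fun N hN => ⟨hN, by simp⟩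
    | insert a t _ ih =>
      obtain ⟨N, hN, h⟩ := ih
      by_cases ha : a ∈ sSup S
      · obtain ⟨N', hN', haN'⟩ := (Submodule.mem_sSup_of_directed hne hd).1 ha
        obtain ⟨K, hK, h1, h2⟩ := hd N hN N' hN'
        refine ⟨K, hK, fun m hm hmS => ?_⟩
        rcases Finset.mem_insert.1 hm with rfl | hm
        exacts [h2 haN', h1 (h m hm hmS)]
      · refine ⟨N, hN, fun m hm hmS => ?_⟩
        rcases Finset.mem_insert.1 hm with rfl | hm
        exacts [absurd hmS ha, h m hm hmS]
  obtain ⟨N, hN, h⟩ := key (s.image (Finsupp.linearCombination R id))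
  obtain ⟨ρ, hρN, hρ⟩ := hS N hN s
  exact ⟨ρ, fun m => le_sSup hN (hρN m), fun c hc hcS =>
    hρ c hc (h _ (Finset.mem_image_of_mem _ hc) hcS)⟩

/-- There is a maximal equationally pure submodule inside any given submodule. -/
theorem exists_maximal (L : Submodule R M) :
    ∃ P : Submodule R M, Maximal (fun P => P.IsEquationallyPure ∧ P ≤ L) P := by
  obtain ⟨P, -, hP⟩ := zorn_le_nonempty₀ {P : Submodule R M | P.IsEquationallyPure ∧ P ≤ L}
    (fun c hc hch N hN => ⟨sSup c, ⟨sSup_of_directedOn ⟨N, hN⟩ hch.directedOn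
      fun K hK => (hc hK).1, sSup_le fun K hK => (hc hK).2⟩, fun K hK => le_sSup hK⟩)
    ⊥ ⟨bot, bot_le⟩
  exact ⟨P, hP⟩

end Submodule.IsEquationallyPure

/-! ### Small quotients by pure submodules. -/

open Cardinal

/-- For operations of possibly infinite arity, a closed subset of bounded cardinality. -/
theorem exists_closed_set_card_le {M A : Type u} (β : A → Type u)
    (op : ∀ a, (β a → M) → M) {κ : Cardinal.{u}}
    (hκ : (Cardinal.sum fun a => κ ^ #(β a)) ≤ κ) :
    ∃ S : Set M, #S ≤ κ ∧ ∀ a (p : β a → M), (∀ b, p b ∈ S) → op a p ∈ S := by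
  let ev : WType β → M := WType.elim M fun x => op x.1 x.2
  refine ⟨Set.range ev, mk_range_le.trans (WType.cardinalMk_le_of_le hκ), fun a p hp => ?_⟩
  choose w hw using hp
  exact ⟨WType.mk a w, congrArg (op a) (funext hw)⟩

/-- With finite arities there are at most `max #A ℵ₀` terms, so no exponential bound on `κ` is
needed. -/
theorem exists_closed_set_card_le_of_finite {M A : Type u} (β : A → Type) [∀ a, Finite (β a)]
    (op : ∀ a, (β a → M) → M) {κ : Cardinal.{u}} (hκ : ℵ₀ ≤ κ) (hA : #A ≤ κ) :
    ∃ S : Set M, #S ≤ κ ∧ ∀ a (p : β a → M), (∀ b, p b ∈ S) → op a p ∈ S := by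
  let ev : WType β → M := WType.elim M fun x => op x.1 x.2
  refine ⟨Set.range ev, mk_range_le.trans ((WType.cardinalMk_le_max_aleph0_of_finite' ..).trans
    (max_le (by simpa using hA) hκ)), fun a p hp => ?_⟩
  choose w hw using hp
  exact ⟨WType.mk a w, congrArg (op a) (funext hw)⟩

section Absorbing

variable {R M M' : Type u} [Ring R] [AddCommGroup M] [Module R M] [AddCommGroup M'] [Module R M']

/-- A subset `B` of `M` of bounded cardinality such that each small submodule of `M` can be
mapped into `B`, without moving its elements in `B` and without changing the values of `f`. -/
theorem exists_absorbing_set (f : M →ₗ[R] M') {μ : Cardinal.{u}} (hμ : ℵ₀ ≤ μ) (hR : #R ≤ μ)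
    (hM' : #M' ≤ μ) :
    ∃ B : Set M, #B ≤ 2 ^ μ ∧ ∀ N : Submodule R M, #N ≤ μ →
      ∃ ρ : N →ₗ[R] M, (∀ n, ρ n ∈ B) ∧ (∀ n : N, (n : M) ∈ B → ρ n = n) ∧
        ∀ n, f (ρ n) = f n := by
  classical
  obtain ⟨S, rfl⟩ : ∃ S : Type u, #S = μ := ⟨μ.out, mk_out μ⟩
  have : Infinite S := infinite_iff.2 hμ
  -- Up to the choice of generators, a small `N` is described by the indices of the generators in
  -- `B`, the relations, and the values of `f`. The last component selects one generator of a chosen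
  -- copy.
  let A := Set S × Set (S →₀ R) × (S → M') × S
  let good (a : A) (p : a.1 → M) (g : S → M) : Prop :=
    (∀ t : a.1, g t = p t) ∧ (∀ c ∈ a.2.1, Finsupp.linearCombination R g c = 0) ∧
      f ∘ g = a.2.2.1
  let op (a : A) (p : a.1 → M) : M :=
    if h : ∃ g, good a p g then h.choose a.2.2.2 else 0
  have hpow : (2 ^ #S : Cardinal.{u}) ^ #S = 2 ^ #S := by rw [← power_mul, mul_eq_self hμ]
  have hinf : ℵ₀ ≤ (2 ^ #S : Cardinal.{u}) := hμ.trans (cantor _).le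
  have hfs : #(S →₀ R) ≤ #S := by
    refine (mk_le_of_injective (Finsupp.graph_injective S R)).trans ?_
    rw [mk_finset_of_infinite, mk_prod, lift_id, lift_id]
    exact (mul_le_mul_right hR _).trans (mul_eq_self hμ).le
  have hA : #A ≤ 2 ^ #S := by
    have h1 : #(Set (S →₀ R)) ≤ 2 ^ #S := by
      rw [mk_set]
      exact power_le_power_left two_ne_zero hfs
    have h2 : #(S → M') ≤ 2 ^ #S := by
      rw [← power_def, ← hpow]
      exact power_le_power_right (hM'.trans (cantor _).le)
    simp only [A, mk_prod, lift_id, mk_set]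
    exact mul_le_of_le hinf le_rfl (mul_le_of_le hinf (by simpa using h1)
      (mul_le_of_le hinf h2 (cantor _).le))
  obtain ⟨B, hBcard, hB⟩ := exists_closed_set_card_le (fun a : A => (a.1 : Type u)) op
    (κ := 2 ^ #S) (by
      refine (sum_le_sum _ (fun _ => 2 ^ #S) fun a => ?_).trans ?_
      · conv_rhs => rw [← hpow]
        exact power_le_power_left (aleph0_pos.trans_le hinf).ne' (mk_set_le a.1)
      · rw [sum_const, lift_id, lift_id]
        exact mul_le_of_le hinf hA le_rfl)
  refine ⟨B, hBcard, fun N hN => ?_⟩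
  obtain ⟨v, hv⟩ : ∃ v : S → N, Function.Surjective v := by
    obtain ⟨i⟩ := hN
    exact ⟨Function.invFun i, Function.invFun_surjective i.injective⟩
  let F : (S →₀ R) →ₗ[R] N := Finsupp.linearCombination R v
  have hF : Function.Surjective F := fun n => by
    obtain ⟨s, rfl⟩ := hv n
    exact ⟨Finsupp.single s 1, by simp [F]⟩
  let T : Set S := {s | (v s : M) ∈ B}
  let Λ : Set (S →₀ R) := {c | F c = 0}
  let p (t : T) : M := v t
  have hgood (s : S) : ∃ g, good (T, Λ, f ∘ (fun s => (v s : M)), s) p g := by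
    refine ⟨fun s => v s, fun t => rfl, fun c hc => ?_, rfl⟩
    have := congrArg N.subtype (show F c = 0 from hc)
    rwa [map_zero, Finsupp.apply_linearCombination] at this
  -- `good` ignores the last component of its data, so all indices share the same chosen tuple `g`.
  let g := (hgood (Classical.arbitrary S)).choose
  have hspec := (hgood (Classical.arbitrary S)).choose_spec
  have hg1 (s : S) (hs : (v s : M) ∈ B) : g s = v s := hspec.1 ⟨s, hs⟩
  have hg2 : LinearMap.ker F ≤ LinearMap.ker (Finsupp.linearCombination R g) :=
    fun c hc => hspec.2.1 c hc
  have hg3 (s : S) : f (g s) = f (v s) := congrFun hspec.2.2 s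
  have hgB (s : S) : g s ∈ B := by
    have := hB (T, Λ, f ∘ (fun s => (v s : M)), s) p fun t => t.2
    simp only [op] at this
    rw [dif_pos (hgood s)] at this
    exact this
  let ρ : N →ₗ[R] M := (LinearMap.ker F).liftQ (Finsupp.linearCombination R g) hg2 ∘ₗ
    (F.quotKerEquivOfSurjective hF).symm.toLinearMap
  have hρ (s : S) : ρ (v s) = g s := by
    have : (F.quotKerEquivOfSurjective hF).symm (v s) =
        (LinearMap.ker F).mkQ (Finsupp.single s 1) := by
      rw [LinearEquiv.symm_apply_eq]
      simp [F]
    simp only [ρ, LinearMap.comp_apply, LinearEquiv.coe_coe, this]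
    simp
  refine ⟨ρ, fun n => ?_, fun n hn => ?_, fun n => ?_⟩ <;> obtain ⟨s, rfl⟩ := hv n <;> rw [hρ]
  · exact hgB s
  · exact hg1 s hn
  · exact hg3 s

/-- A small submodule that contains solutions of all linear systems `b - c = A x` with given `b`
in the submodule and with `c` in the prescribed set `B`. -/
theorem exists_submodule_closed_under_solutions (B : Set M) (x₀ : M) {μ : Cardinal.{u}}
    (hμ : ℵ₀ ≤ μ) (hR : #R ≤ μ) :
    ∃ N : Submodule R M, #N ≤ μ ∧ x₀ ∈ N ∧
      ∀ (k n : ℕ) (A : Fin k → Fin n → R) (b : Fin k → M), (∀ i, b i ∈ N) →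
        (∃ (x : Fin n → M) (c : Fin k → M),
          (∀ i, c i ∈ B) ∧ ∀ i, b i - c i = ∑ j, A i j • x j) →
        ∃ (x : Fin n → M) (c : Fin k → M), (∀ j, x j ∈ N) ∧ (∀ i, c i ∈ N) ∧
          (∀ i, c i ∈ B) ∧ ∀ i, b i - c i = ∑ j, A i j • x j := by
  classical
  let E := Σ k n : ℕ, (Fin k → Fin n → R) × (Fin n ⊕ Fin k)
  let good (a : E) (b : Fin a.1 → M) (xc : Fin a.2.1 ⊕ Fin a.1 → M) : Prop :=
    (∀ i, xc (.inr i) ∈ B) ∧ ∀ i, b i - xc (.inr i) = ∑ j, a.2.2.1 i j • xc (.inl j)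
  let sol (a : E) (b : Fin a.1 → M) : M :=
    if h : ∃ xc, good a b xc then h.choose a.2.2.2 else 0
  -- The operations are the constant `x₀`, the binary linear combinations, and the components of
  -- chosen solutions; all are finitary.
  let β : Unit ⊕ (R × R) ⊕ E → Type
    | .inl _ => Empty
    | .inr (.inl _) => Bool
    | .inr (.inr a) => Fin a.1
  have : ∀ a, Finite (β a) := by
    rintro (_ | _ | a)
    · exact inferInstanceAs (Finite Empty)
    · exact inferInstanceAs (Finite Bool)
    · exact inferInstanceAs (Finite (Fin a.1))
  let op : ∀ a, (β a → M) → M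
    | .inl _, _ => x₀
    | .inr (.inl r), p => r.1 • p true + r.2 • p false
    | .inr (.inr a), p => sol a p
  have hE : #E ≤ μ := by
    have (k n : ℕ) : #((Fin k → Fin n → R) × (Fin n ⊕ Fin k)) ≤ μ := by
      rw [mk_prod]
      refine mul_le_of_le hμ ?_ ((lift_le_aleph0.2 (mk_le_aleph0)).trans hμ)
      simp only [lift_id', mk_pi, prod_const, mk_fin, lift_natCast, power_natCast]
      exact (pow_le_pow_left' (pow_le_pow_left' hR _) _).trans
        ((pow_le_pow_left' (power_nat_le hμ) _).trans (power_nat_le hμ))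
    have sum_le (a : ℕ → Cardinal.{u}) (ha : ∀ n, a n ≤ μ) : Cardinal.sum a ≤ μ := by
      refine (sum_le_sum a (fun _ => μ) ha).trans ?_
      rw [sum_const]
      exact mul_le_of_le hμ (by simpa using hμ) (by simp)
    rw [mk_sigma]
    refine sum_le _ fun k => ?_
    rw [mk_sigma]
    exact sum_le _ fun n => this k n
  obtain ⟨S, hS, hop⟩ := exists_closed_set_card_le_of_finite β op hμ (by
    rw [mk_sum, mk_sum, mk_prod]
    simp only [lift_id, lift_uzero, mk_unit, lift_one]
    exact add_le_of_le hμ (one_le_aleph0.trans hμ)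
      (add_le_of_le hμ (mul_le_of_le hμ hR hR) hE))
  have hx₀ : x₀ ∈ S := hop (.inl ()) (fun b => b.elim) fun b => b.elim
  have hlin (r r' : R) {x y : M} (hx : x ∈ S) (hy : y ∈ S) : r • x + r' • y ∈ S :=
    hop (.inr (.inl (r, r'))) (fun b : Bool => if b then x else y) (by
      rintro (_ | _)
      exacts [hy, hx])
  refine ⟨{ carrier := S
            zero_mem' := by simpa using hlin 0 0 hx₀ hx₀
            add_mem' := fun hx hy => by simpa using hlin 1 1 hx hy
            smul_mem' := fun r x hx => by simpa using hlin r 0 hx hx }, hS, hx₀, ?_⟩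
  rintro k n A b hb ⟨x, c, hc, hxc⟩
  have hgood (i : Fin n ⊕ Fin k) : ∃ xc, good ⟨k, n, A, i⟩ b xc := ⟨Sum.elim x c, hc, hxc⟩
  have hmem (i : Fin n ⊕ Fin k) : (hgood i).choose i ∈ S := by
    have := hop (.inr (.inr ⟨k, n, A, i⟩)) b hb
    simp only [op, sol] at this
    rw [dif_pos (hgood i)] at this
    exact this
  -- Without unknowns and equations there is no index at which to invoke `hgood`, but the conditions
  -- are vacuous.
  rcases isEmpty_or_nonempty (Fin n ⊕ Fin k) with hi | ⟨⟨i₀⟩⟩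
  · exact ⟨x, c, fun j => (hi.false (.inl j)).elim, fun i => (hi.false (.inr i)).elim, hc, hxc⟩
  · obtain ⟨h1, h2⟩ := (hgood i₀).choose_spec
    exact ⟨fun j => (hgood i₀).choose (.inl j), fun i => (hgood i₀).choose (.inr i),
      fun j => hmem (.inl j), fun i => hmem (.inr i), h1, h2⟩

/-- A large module contains a nonzero equationally pure submodule on which a given homomorphism
to a small module vanishes. -/
theorem exists_isEquationallyPure_le_ker (f : M →ₗ[R] M') {μ : Cardinal.{u}} (hμ : ℵ₀ ≤ μ)
    (hR : #R ≤ μ) (hM' : #M' ≤ μ) (hM : 2 ^ μ < #M) :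
    ∃ P : Submodule R M, P.IsEquationallyPure ∧ P ≤ LinearMap.ker f ∧ P ≠ ⊥ := by
  obtain ⟨B, hBcard, hB⟩ := exists_absorbing_set f hμ hR hM'
  obtain ⟨m, hm⟩ : ∃ m, m ∉ B := by
    by_contra! h
    rw [Set.eq_univ_of_forall h, mk_univ] at hBcard
    exact hM.not_ge hBcard
  obtain ⟨N, hNcard, hmN, hN⟩ := exists_submodule_closed_under_solutions (R := R) B m hμ hR
  obtain ⟨ρ, hρB, hρ, hfρ⟩ := hB N hNcard
  -- If `A x = b - ρ b`, then `N` contains `y` and `c`, with `c` in `B`, such that `A y = b - c`.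
  -- Apply `id - ρ`, which kills `c`. The range is nonzero because `ρ m` lies in `B` and `m` does
  -- not.
  refine ⟨LinearMap.range (N.subtype - ρ), .of_finite_systems fun k n A x hx => ?_, ?_, ?_⟩
  · choose b hb using hx
    obtain ⟨y, c, hyN, hcN, hcB, hyc⟩ := hN k n A (fun i => b i) (fun i => (b i).2)
      ⟨x, fun i => ρ (b i), fun i => hρB _, fun i => hb i⟩
    lift y to Fin n → N using hyN
    lift c to Fin k → N using hcN
    refine ⟨fun j => (N.subtype - ρ) (y j), fun j => ⟨_, rfl⟩, fun i => ?_⟩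
    have : b i - c i = ∑ j, A i j • y j := Subtype.ext (by simpa using hyc i)
    rw [← hb i]
    simp only [← map_smul, ← map_sum, ← this]
    rw [map_sub]
    simp [hρ (c i) (hcB i)]
  · rintro _ ⟨n, rfl⟩
    simp [hfρ]
  · intro h
    have : (N.subtype - ρ) ⟨m, hmN⟩ = 0 := by
      rw [LinearMap.range_eq_bot.1 h]
      rfl
    rw [LinearMap.sub_apply, sub_eq_zero] at this
    exact hm (Eq.subst (motive := (· ∈ B)) this.symm (hρB ⟨m, hmN⟩))

/-- A homomorphism to a small module factors through a small quotient by an equationally pure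
submodule. -/
theorem exists_isEquationallyPure_quotient_card_le (f : M →ₗ[R] M') {μ : Cardinal.{u}}
    (hμ : ℵ₀ ≤ μ) (hR : #R ≤ μ) (hM' : #M' ≤ μ) :
    ∃ P : Submodule R M, P.IsEquationallyPure ∧ P ≤ LinearMap.ker f ∧ #(M ⧸ P) ≤ 2 ^ μ := by
  obtain ⟨P, ⟨hP, hPf⟩, hmax⟩ := Submodule.IsEquationallyPure.exists_maximal (LinearMap.ker f)
  refine ⟨P, hP, hPf, ?_⟩
  by_contra! h
  obtain ⟨N, hN, hNf, hne⟩ := exists_isEquationallyPure_le_ker (P.liftQ f hPf) hμ hR hM' h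
  have hle : P ≤ N.comap P.mkQ := fun p hp => by
    have : P.mkQ p = 0 := by simpa using hp
    simp [Submodule.mem_comap, this]
  have := hmax ⟨hP.comap_mkQ hN, fun m hm => by simpa using hNf hm⟩ hle
  refine hne (eq_bot_iff.2 fun n hn => ?_)
  obtain ⟨m, rfl⟩ := P.mkQ_surjective n
  simpa using this hn

end Absorbing

open Limits

/-! ### Weakly terminal objects in categories with filtered colimits. -/

section Chains

/-- In a category with filtered colimits, morphisms with a property that every object is the
source of compose to transfinite chains that are longer than any given set. -/
theorem CategoryTheory.MorphismProperty.exists_long_chain {C : Type*} [Category.{u} C]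
    [HasFilteredColimitsOfSize.{u, u} C] [Nonempty C] (W : MorphismProperty C)
    (hW : ∀ X : C, ∃ (Y : C) (f : X ⟶ Y), W f) (S : Type u) :
    ∃ (J : Type u) (_ : LinearOrder J) (_ : SuccOrder J) (_ : NoMaxOrder J) (_ : Nonempty J)
      (D : J ⥤ C), (∀ j, W (D.map (homOfLE (Order.le_succ j)))) ∧
        ∀ f : J → S, ¬ Function.Injective f := by
  -- An infinite initial ordinal has no largest element, and this one has more elements than `S`.
  let c := max ℵ₀ (Order.succ #S)
  have hc : ℵ₀ ≤ c := le_max_left _ _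
  let J := c.ord.ToType
  have : NoMaxOrder J := noMaxOrder hc
  have hJ : #J = c := by simp [J]
  have : Nonempty J := mk_ne_zero_iff.1 (hJ ▸ (aleph0_pos.trans_le hc).ne')
  let _ : OrderBot J := WellFoundedLT.toOrderBot J
  have : HasIterationOfShape J C :=
    { hasColimitsOfShape_of_isSuccLimit := fun j hj => by
        have : Nonempty (Set.Iio j) := by
          obtain ⟨i, hi⟩ := not_isMin_iff.1 hj.not_isMin
          exact ⟨⟨i, hi⟩⟩
        infer_instance }
  choose Y f hf using hW
  let Φ : SmallObject.SuccStruct C := ⟨Classical.arbitrary C, Y, f⟩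
  refine ⟨J, inferInstance, inferInstance, inferInstance, inferInstance, Φ.iterationFunctor J,
    fun j => ?_, fun g hg => ?_⟩
  · have := (Φ.prop_iff _).1 (Φ.prop_iterationFunctor_map_succ j (not_isMax j))
    exact (W.arrow_mk_mem_toSet_iff _).1 (this ▸ (W.arrow_mk_mem_toSet_iff _).2 (hf _))
  · have := mk_le_of_injective hg
    rw [hJ] at this
    exact ((Order.lt_succ #S).trans_le (le_max_right _ _)).not_ge this

variable {C : Type*} [Category.{u} C] [HasFilteredColimitsOfSize.{u, u} C] (G : C ⥤ Type u)

/-- Out of any object there is a morphism that identifies all that can be identified later on. -/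
theorem CategoryTheory.Functor.exists_hom_kernel_stable (X : C) :
    ∃ (Y : C) (f : X ⟶ Y), ∀ (Z : C) (g : Y ⟶ Z) (a b : G.obj X),
      G.map (f ≫ g) a = G.map (f ≫ g) b → G.map f a = G.map f b := by
  by_contra! h
  have : HasFilteredColimitsOfSize.{u, u} (Under X) := ⟨fun J _ _ => by
    have : IsConnected J := IsFiltered.isConnected J
    infer_instance⟩
  -- Every step identifies a new pair, so a long chain would have too many distinct kernels on
  -- `G.obj X`.
  let W : MorphismProperty (Under X) := fun Y Z _ => ∃ a b : G.obj X,
    G.map Z.hom a = G.map Z.hom b ∧ G.map Y.hom a ≠ G.map Y.hom b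
  have : Nonempty (Under X) := ⟨Under.mk (𝟙 X)⟩
  obtain ⟨J, _, _, _, _, D, hD, hJ⟩ := W.exists_long_chain (fun Y => by
    obtain ⟨Z, g, a, b, hab⟩ := h Y.right Y.hom
    exact ⟨Under.mk (Y.hom ≫ g), Under.homMk g, a, b, hab⟩) (Set (G.obj X × G.obj X))
  let K (j : J) : Set (G.obj X × G.obj X) :=
    {p | G.map (D.obj j).hom p.1 = G.map (D.obj j).hom p.2}
  have hK : Monotone K := fun i j hij p hp => by
    have hw := Under.w (D.map (homOfLE hij))
    change G.map (D.obj j).hom p.1 = G.map (D.obj j).hom p.2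
    rw [← hw, G.map_comp]
    exact congrArg (G.map (D.map (homOfLE hij)).right) hp
  refine hJ K (StrictMono.injective fun i j hij => ?_)
  obtain ⟨a, b, h1, h2⟩ := hD i
  refine lt_of_le_of_ne (hK hij.le) fun heq => h2 ?_
  have : (a, b) ∈ K j := hK (Order.succ_le_of_lt hij) h1
  rw [← heq] at this
  exact this

variable [PreservesFilteredColimitsOfSize.{u, u} G]

/-- Take the colimit of a chain with kernel-stable steps: two elements identified by a morphism out
of it come from one stage and agree already at the next. Routing each step through `X` gives the
morphism from `X`. Any limit length will do, hence `PUnit`. -/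
theorem CategoryTheory.Functor.exists_weakly_terminal_injective (X : C)
    (hX : ∀ Y : C, Nonempty (Y ⟶ X)) :
    ∃ Y : C, Nonempty (X ⟶ Y) ∧
      ∀ (Z : C) (f : Y ⟶ Z), Function.Injective (G.map f) := by
  let W : MorphismProperty C := fun Y Y' f => Nonempty (X ⟶ Y') ∧
    ∀ (Z : C) (g : Y' ⟶ Z) (a b : G.obj Y),
      G.map (f ≫ g) a = G.map (f ≫ g) b → G.map f a = G.map f b
  have : Nonempty C := ⟨X⟩
  obtain ⟨J, _, _, _, _, D, hD, -⟩ := W.exists_long_chain (fun Y => by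
    obtain ⟨Z, f, hf⟩ := G.exists_hom_kernel_stable Y
    obtain ⟨r⟩ := hX Z
    refine ⟨X, f ≫ r, ⟨𝟙 X⟩, fun Z' g a b hab => ?_⟩
    rw [G.map_comp]
    refine congrArg (G.map r) (hf Z' (r ≫ g) a b ?_)
    simpa using hab) PUnit
  have hc := isColimitOfPreserves G (colimit.isColimit D)
  refine ⟨colimit D, ?_, fun Z f x y hxy => ?_⟩
  · obtain ⟨g⟩ := (hD (Classical.arbitrary J)).1
    exact ⟨g ≫ colimit.ι D _⟩
  · obtain ⟨i, x, rfl⟩ := Types.jointly_surjective _ hc x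
    obtain ⟨j, y, rfl⟩ := Types.jointly_surjective _ hc y
    obtain ⟨k, hik, hjk⟩ := exists_ge_ge i j
    have hw {i k : J} (hik : i ≤ k) (x : G.obj (D.obj i)) :
        G.map (colimit.ι D i) x = G.map (colimit.ι D k) (G.map (D.map (homOfLE hik)) x) := by
      rw [← colimit.w D (homOfLE hik), G.map_comp]
      rfl
    change G.map f (G.map (colimit.ι D i) x) = G.map f (G.map (colimit.ι D j) y) at hxy
    change G.map (colimit.ι D i) x = G.map (colimit.ι D j) y
    rw [hw hik, hw hjk] at hxy ⊢
    generalize G.map (D.map (homOfLE hik)) x = x' at *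
    generalize G.map (D.map (homOfLE hjk)) y = y' at *
    have h := (hD k).2 Z (colimit.ι D _ ≫ f) x' y' (by
      rw [← Category.assoc, colimit.w, G.map_comp]
      exact hxy)
    rw [hw (Order.le_succ k), hw (Order.le_succ k), h]

/-- If a category with filtered colimits has a weakly terminal object, then it has one whose
endomorphisms are bijective. -/
theorem CategoryTheory.Functor.exists_weakly_terminal_bijective (X : C)
    (hX : ∀ Y : C, Nonempty (Y ⟶ X)) :
    ∃ Y : C, (∀ Z : C, Nonempty (Z ⟶ Y)) ∧
      ∀ e : Y ⟶ Y, Function.Bijective (G.map e) := by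
  obtain ⟨Y, ⟨r⟩, hY⟩ := G.exists_weakly_terminal_injective X hX
  have hY' (Z : C) : Nonempty (Z ⟶ Y) := ⟨(hX Z).some ≫ r⟩
  refine ⟨Y, hY', fun e => ⟨hY Y e, ?_⟩⟩
  by_contra he
  -- If `e` is not surjective, neither is `g ≫ e` for any `g : Z ⟶ Y`, so such steps can be
  -- continued from every object.
  let W : MorphismProperty C := fun Z Z' f => ¬ Function.Surjective (G.map f) ∧
    ∀ (T : C) (f : Z' ⟶ T), Function.Injective (G.map f)
  have : Nonempty C := ⟨X⟩
  obtain ⟨J, _, _, _, _, D, hD, hJ⟩ := W.exists_long_chain (fun Z => by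
    obtain ⟨g⟩ := hY' Z
    refine ⟨Y, g ≫ e, fun hs => he fun y => ?_, hY⟩
    obtain ⟨z, hz⟩ := hs y
    exact ⟨G.map g z, by simpa using hz⟩) (Set (G.obj Y))
  obtain ⟨p⟩ := hY' (colimit D)
  let q (j : J) : G.obj (D.obj j) → G.obj Y := G.map (colimit.ι D j ≫ p)
  have hq {i j : J} (hij : i ≤ j) (x) : q j (G.map (D.map (homOfLE hij)) x) = q i x := by
    simp only [q]
    rw [← colimit.w D (homOfLE hij), Category.assoc, G.map_comp (D.map _)]
    rfl
  have hmono : Monotone fun j => Set.range (q j) := by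
    rintro i j hij _ ⟨x, rfl⟩
    exact ⟨_, hq hij x⟩
  have hinj (j : J) : Function.Injective (q (Order.succ j)) := (hD j).2 _ _
  -- The images in `G.obj Y` grow strictly. Successor stages are used because injectivity of
  -- outgoing morphisms is known only for targets of steps.
  refine hJ (fun j => Set.range (q (Order.succ j))) (StrictMono.injective fun i j hij => ?_)
  refine lt_of_le_of_ne (hmono (Order.succ_le_succ hij.le)) fun heq => ?_
  refine (hD (Order.succ i)).1 fun y => ?_
  obtain ⟨x, hx⟩ : q (Order.succ (Order.succ i)) y ∈ Set.range (q (Order.succ i)) := by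
    rw [heq]
    exact hmono (Order.succ_le_succ (Order.succ_le_of_lt hij)) ⟨y, rfl⟩
  exact ⟨x, hinj _ ((hq _ x).trans hx)⟩

end Chains

/-! ### Filtered colimits as pure quotients. -/

section DirectSum

variable {R : Type u} [Ring R]

/-- A filtered colimit of modules is a pure quotient of the direct sum of the modules. -/
theorem Submodule.IsEquationallyPure.ker_toModule_of_isColimit {J : Type u} [SmallCategory J]
    [IsFiltered J] [DecidableEq J] {D : J ⥤ ModuleCat.{u} R} {c : Cocone D} (hc : IsColimit c) :
    (LinearMap.ker (DirectSum.toModule R J c.pt fun j => (c.ι.app j).hom)).IsEquationallyPure := by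
  classical
  intro s
  let π := DirectSum.toModule R J c.pt fun j => (c.ι.app j).hom
  have hw {j k : J} (f : j ⟶ k) (x : D.obj j) :
      (c.ι.app k).hom ((D.map f).hom x) = (c.ι.app j).hom x := by
    rw [← c.w f]
    rfl
  let T : Finset (⨁ j, D.obj j) := s.biUnion Finsupp.support ∪
    s.image (Finsupp.linearCombination R id)
  let O : Finset J := T.biUnion DFinsupp.support
  obtain ⟨k, hk⟩ := IsFiltered.sup_objs_exists O
  -- On the components that occur in `T`, `t` pushes everything to stage `k`; its value 0 on the
  -- others is immaterial.
  let t : (⨁ j, D.obj j) →ₗ[R] D.obj k := DirectSum.toModule R J _ fun j =>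
    if hj : j ∈ O then (D.map (hk hj).some).hom else 0
  have ht (x) (hx : x ∈ T) : (c.ι.app k).hom (t x) = π x := by
    have hxO : DFinsupp.support x ⊆ O := Finset.subset_biUnion_of_mem DFinsupp.support hx
    rw [← DirectSum.sum_support_of x]
    simp only [map_sum]
    refine Finset.sum_congr rfl fun j hj => ?_
    simp only [t, π, ← DirectSum.lof_eq_of R, DirectSum.toModule_lof, dif_pos (hxO hj), hw]
  -- Passing to later stages makes `t` vanish on the finitely many elements of `T` that vanish in
  -- the colimit.
  have key (A : Finset (⨁ j, D.obj j)) : ∃ (k : J) (t : (⨁ j, D.obj j) →ₗ[R] D.obj k),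
      (∀ x ∈ T, (c.ι.app k).hom (t x) = π x) ∧ ∀ x ∈ A, x ∈ T → π x = 0 → t x = 0 := by
    induction A using Finset.induction_on with
    | empty => exact ⟨k, t, ht, by simp⟩
    | insert a A _ ih =>
      obtain ⟨k, t, ht, hA⟩ := ih
      by_cases ha : a ∈ T ∧ π a = 0
      · obtain ⟨k', f, g, hfg⟩ := (Concrete.isColimit_rep_eq_iff_exists D (j := k) hc (t a) 0).1 (by
          simpa using (ht a ha.1).trans ha.2)
        refine ⟨k', (D.map f).hom ∘ₗ t, fun x hx => ?_, fun x hx hxT hx0 => ?_⟩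
        · rw [LinearMap.comp_apply, hw, ht x hx]
        · rcases Finset.mem_insert.1 hx with rfl | hx
          · simpa using hfg
          · rw [LinearMap.comp_apply, hA x hx hxT hx0, map_zero]
      · refine ⟨k, t, ht, fun x hx hxT hx0 => ?_⟩
        rcases Finset.mem_insert.1 hx with rfl | hx
        exacts [absurd ⟨hxT, hx0⟩ ha, hA x hx hxT hx0]
  obtain ⟨k, t, ht, hT⟩ := key T
  -- `δ` sends `T` into the kernel and fixes the elements of `T` already in the kernel.
  let δ : (⨁ j, D.obj j) →ₗ[R] ⨁ j, D.obj j :=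
    LinearMap.id - DirectSum.lof R J (fun j => D.obj j) k ∘ₗ t
  refine ⟨fun x => if x ∈ T then δ x else 0, fun x => ?_, fun e he h0 => ?_⟩
  · dsimp only
    split_ifs with hx
    · change π (δ x) = 0
      simp only [δ, LinearMap.sub_apply, LinearMap.comp_apply, map_sub, LinearMap.id_apply]
      rw [← ht x hx, sub_eq_zero]
      simp only [π, DirectSum.toModule_lof]
    · exact Submodule.zero_mem _
  · have hδ : Finsupp.linearCombination R (fun x => if x ∈ T then δ x else 0) e =
        δ (Finsupp.linearCombination R id e) := by
      rw [Finsupp.apply_linearCombination, Finsupp.linearCombination_apply,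
        Finsupp.linearCombination_apply]
      refine Finset.sum_congr rfl fun x hx => ?_
      have hxT : x ∈ T := Finset.mem_union_left _ (Finset.mem_biUnion.2 ⟨e, he, hx⟩)
      dsimp only
      rw [if_pos hxT]
      rfl
    have hmem : Finsupp.linearCombination R id e ∈ T :=
      Finset.mem_union_right _ (Finset.mem_image_of_mem _ he)
    rw [hδ]
    simp [δ, hT _ hmem hmem h0]

end DirectSum

/-! ### The implications between the three conditions. -/

namespace PureCover

variable {R : Type u} [Ring R] {F : ObjectProperty (ModuleCat.{u} R)}

theorem ClosedUnderPureQuotients.of_surjective [F.IsClosedUnderIsomorphisms]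
    (hF : ClosedUnderPureQuotients F) {M N : ModuleCat.{u} R} (hM : F M) (f : M →ₗ[R] N)
    (hf : Function.Surjective f) (hk : (LinearMap.ker f).IsEquationallyPure) : F N :=
  F.prop_of_iso (f.quotKerEquivOfSurjective hf).toModuleIso
    (hF M hM _ (isPure_of_isEquationallyPure hk))

theorem IsPrecovering.closedUnderDirectSums [F.IsClosedUnderIsomorphisms]
    (hF : ClosedUnderPureQuotients F) (h : IsPrecovering F) : ClosedUnderDirectSums F := by
  classical
  intro ι M hM
  obtain ⟨X, φ, hX, hφ⟩ := h (ModuleCat.of R (⨁ i, M i))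
  choose g hg using fun i => hφ (M i) (hM i) (ModuleCat.ofHom (DirectSum.lof R ι (fun i => M i) i))
  let σ : (⨁ i, M i) →ₗ[R] X := DirectSum.toModule R ι X fun i => (g i).hom
  have hσ : φ.hom ∘ₗ σ = LinearMap.id := by
    refine DirectSum.linearMap_ext R fun i => LinearMap.ext fun m => ?_
    have := congrArg (fun f => f.hom m) (hg i)
    simpa [σ] using this
  exact hF.of_surjective hX φ.hom (fun x => ⟨σ x, LinearMap.congr_fun hσ x⟩)
    (.ker_of_comp_eq_id hσ)

theorem ClosedUnderDirectSums.isPrecovering [F.IsClosedUnderIsomorphisms]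
    (hF : ClosedUnderPureQuotients F) (h : ClosedUnderDirectSums F) : IsPrecovering F := by
  classical
  intro M
  let μ : Cardinal.{u} := max (max #R #M) ℵ₀
  obtain ⟨K, hK⟩ : ∃ K : Type u, #K = 2 ^ μ := ⟨_, mk_out _⟩
  -- Module structures on subsets of `K` represent all modules of size at most `2 ^ μ` by a set.
  let ι : Type u := Σ (S : Set K) (_ : AddCommGroup S) (_ : Module R S),
    {f : S →ₗ[R] M // F (ModuleCat.of R S)}
  let i₁ (i : ι) : AddCommGroup i.1 := i.2.1
  let i₂ (i : ι) : Module R i.1 := i.2.2.1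
  let Y (i : ι) : ModuleCat.{u} R := ModuleCat.of R i.1
  let f (i : ι) : Y i →ₗ[R] M := i.2.2.2.1
  refine ⟨ModuleCat.of R (⨁ i, Y i), ModuleCat.ofHom (DirectSum.toModule R ι M f),
    h ι Y fun i => i.2.2.2.2, fun X hX g => ?_⟩
  obtain ⟨P, hP, hPg, hcard⟩ := exists_isEquationallyPure_quotient_card_le g.hom (μ := μ)
    (le_max_right _ _) ((le_max_left _ _).trans (le_max_left _ _))
    ((le_max_right _ _).trans (le_max_left _ _))
  rw [← hK] at hcard
  obtain ⟨j⟩ := hcard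
  let e : Set.range j ≃ X ⧸ P := (Equiv.ofInjective j j.injective).symm
  let _ : AddCommGroup (Set.range j) := e.addCommGroup
  let _ : Module R (Set.range j) := e.module R
  let e' : Set.range j ≃ₗ[R] X ⧸ P := e.linearEquiv R
  let i : ι := ⟨Set.range j, inferInstance, inferInstance,
    P.liftQ g.hom hPg ∘ₗ e'.toLinearMap, F.prop_of_iso e'.symm.toModuleIso
      (hF X hX P (isPure_of_isEquationallyPure hP))⟩
  refine ⟨ModuleCat.ofHom (DirectSum.lof R ι (fun i => Y i) i ∘ₗ
    (e'.symm.toLinearMap ∘ₗ P.mkQ : X →ₗ[R] Y i)), ?_⟩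
  ext x
  simp [f, i]

theorem ClosedUnderDirectSums.isClosedUnderColimitsOfShape [F.IsClosedUnderIsomorphisms]
    (hF : ClosedUnderPureQuotients F) (h : ClosedUnderDirectSums F) (J : Type u)
    [SmallCategory J] [IsFiltered J] : F.IsClosedUnderColimitsOfShape J := by
  classical
  refine ⟨?_⟩
  rintro N ⟨⟨⟨D, ι, hc⟩, hD⟩⟩
  refine hF.of_surjective (h J D.obj hD) _ (fun x => ?_)
    (.ker_toModule_of_isColimit hc)
  obtain ⟨j, y, hy⟩ := Concrete.isColimit_exists_rep D hc x
  exact ⟨DirectSum.lof R J (fun j => D.obj j) j y, by simpa using hy⟩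

/-- Precovers of `M` are the weakly terminal objects of the full subcategory of `Over M` on the
class; bijectivity on underlying sets makes their endomorphisms isomorphisms. -/
theorem ClosedUnderDirectSums.isCovering [F.IsClosedUnderIsomorphisms]
    (hF : ClosedUnderPureQuotients F) (h : ClosedUnderDirectSums F) : IsCovering F := by
  intro M
  let P : ObjectProperty (Over M) := F.inverseImage (Over.forget M)
  have hP (J : Type u) [SmallCategory J] [IsFiltered J] : P.IsClosedUnderColimitsOfShape J := by
    have := h.isClosedUnderColimitsOfShape hF J
    infer_instance
  have : HasFilteredColimitsOfSize.{u, u} P.FullSubcategory := ⟨fun J _ _ => by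
    have := hP J
    infer_instance⟩
  let G : P.FullSubcategory ⥤ Type u := P.ι ⋙ Over.forget M ⋙ CategoryTheory.forget _
  have : PreservesFilteredColimitsOfSize.{u, u} G := ⟨fun J _ _ => by
    have := hP J
    infer_instance⟩
  obtain ⟨X, φ, hX, hφ⟩ := h.isPrecovering hF M
  obtain ⟨Y, hY, hbij⟩ := G.exists_weakly_terminal_bijective ⟨Over.mk φ, hX⟩ (fun Z => by
    obtain ⟨g, hg⟩ := hφ Z.obj.left Z.property Z.obj.hom
    exact ⟨ObjectProperty.homMk (Over.homMk g hg)⟩)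
  refine ⟨Y.obj.left, Y.obj.hom, ⟨Y.property, fun Z hZ g => ?_⟩, fun e he => ?_⟩
  · obtain ⟨k⟩ := hY ⟨Over.mk g, hZ⟩
    exact ⟨k.hom.left, Over.w k.hom⟩
  · rw [ConcreteCategory.isIso_iff_bijective]
    exact hbij (ObjectProperty.homMk (Over.homMk e he))

end PureCover

theorem theorem2p5 (R : Type u) [Ring R]
    (F : CategoryTheory.ObjectProperty (ModuleCat.{u} R)) (hiso : F.IsClosedUnderIsomorphisms)
    (hpure : PureCover.ClosedUnderPureQuotients F) :
    List.TFAE [PureCover.ClosedUnderDirectSums F, PureCover.IsPrecovering F,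
      PureCover.IsCovering F] := by
  tfae_have 1 → 3 := fun h => h.isCovering hpure
  tfae_have 3 → 2 := fun h M => by
    obtain ⟨X, φ, hφ⟩ := h M
    exact ⟨X, φ, hφ.1⟩
  tfae_have 2 → 1 := fun h => h.closedUnderDirectSums hpure
  tfae_finish
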